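/- Let $(\Omega,\mathcal F,P)$ be a probability space. Let $u:\mathbb R\to\mathbb R$ be convex, increasing (in the weak sense) and continuously differentiable almost everywhere, with derivative $u'$; at the at most countably many points where $u$ is not differentiable, $u'$ is given any value that keeps it increasing (e.g. the left derivative). Assume that there are $a,b\in\mathbb R$ with $u'(a)<1<u'(b)$. The function $u$ need not be Lipschitz. Let $X$ be a real random variable such that $u(-X-t)$ and $u'(-X-t)$ are integrable for every $t\in\mathbb R$. Assume that $u$ is continuously differentiable on $\mathbb R$, or that the cumulative distribution function of $X$ is continuous. Define $$\mathrm{SR}(X)=\inf\{t\in\mathbb R:\ \mathbb E[u'(-X-t)]\le 1\},\qquad \mathrm{OCE}_u(X)=\inf_{t\in\mathbb R}\{t+\mathbb E[u(-X-t)]\},$$ and, for $m\ge 1$ and $\mathbf z\in\mathbb R^m$, $$\overline{\mathrm{SR}}_m(\mathbf z)=\inf\Big\{t\in\mathbb R:\ \tfrac1m\sum_{j=1}^m u'(-z_j-t)\le 1\Big\},\qquad \mathrm{OCE}_m(\mathbf z)=\overline{\mathrm{SR}}_m(\mathbf z)+\tfrac1m\sum_{j=1}^m u\big(-z_j-\overline{\mathrm{SR}}_m(\mathbf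 z)\big).$$ Suppose that $\sigma_2,\sigma_3>0$ satisfy $$\mathrm{Var}\big(u'(-X-\mathrm{SR}(X))\big)\le\sigma_2^2,\qquad \mathrm{Var}\big(u(-X-\mathrm{SR}(X))\big)\le\sigma_3^2,$$ and that $\|X\|_{L^q}\le T$ for some $q\in(4,\infty]$ and $T>0$. Let $m\ge1$ and let $\mathbf Z=(Z_1,\dots,Z_m)$ be i.i.d. with the distribution of $X$. Then $\mathrm{OCE}_m(\mathbf Z)-\mathrm{OCE}_u(X)$ is square integrable, $$\mathbb E\big[|\mathrm{OCE}_m(\mathbf Z)-\mathrm{OCE}_u(X)|\big]\le\frac{6\sqrt{3(\sigma_2^2+1)}\,T}{m^{1/4}}+\frac{\sigma_3}{\sqrt m},$$ and $$\mathbb E\big[|\mathrm{OCE}_m(\mathbf Z)-\mathrm{OCE}_u(X)|^2\big]\le\frac{216(\sigma_2^2+1)T^2}{\sqrt m}+\frac{\sigma_3^2}{m}.$$ -/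

import Mathlib

open MeasureTheory ProbabilityTheory

noncomputable section

/-- `X` is a random variable such that `f (-X - t)` is integrable for every real `t`. -/
structure MemRiskSpace {Ω : Type*} [MeasurableSpace Ω] (f : ℝ → ℝ) (X : Ω → ℝ)
    (P : Measure Ω) : Prop where
  measurable : Measurable X
  integrable : ∀ t : ℝ, Integrable (fun ω => f (-X ω - t)) P

/-- `u` is a utility function with derivative `u'`: `u` is convex and increasing, it is continuously
differentiable almost everywhere, and `u'` takes values on both sides of `1`.

At the (at most countably many) kinks of `u`, where the derivative does not exist, `u'` may take any
value that keeps `u'` increasing (for instance the left or the right derivative). -/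
structure IsUtility (u u' : ℝ → ℝ) : Prop where
  convex : ConvexOn ℝ Set.univ u
  mono : Monotone u
  hasDerivAt : ∀ x, DifferentiableAt ℝ u x → HasDerivAt u (u' x) x
  deriv_mono : Monotone u'
  ae_contDiff : ∀ᵐ x : ℝ, DifferentiableAt ℝ u x ∧ ContinuousAt u' x
  exists_lt_one : ∃ a, u' a < 1
  exists_one_lt : ∃ b, 1 < u' b

/-- Utility-based shortfall risk of `X` for the loss function `l` and the threshold `lam`. -/
def shortfallRisk {Ω : Type*} [MeasurableSpace Ω] (l : ℝ → ℝ) (lam : ℝ) (X : Ω → ℝ)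
    (P : Measure Ω) : ℝ :=
  sInf {t : ℝ | ∫ ω, l (-X ω - t) ∂P ≤ lam}

/-- Optimized certainty equivalent risk of `X` for the utility function `u`. -/
def oceRisk {Ω : Type*} [MeasurableSpace Ω] (u : ℝ → ℝ) (X : Ω → ℝ) (P : Measure Ω) : ℝ :=
  ⨅ t : ℝ, (t + ∫ ω, u (-X ω - t) ∂P)

/-- Sample average approximation of the shortfall risk for the loss `u'` and the threshold `1`:
the smallest `t` whose empirical mean loss is at most `1`. -/
def saaShortfall (u' : ℝ → ℝ) {m : ℕ} (z : Fin m → ℝ) : ℝ :=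
  sInf {t : ℝ | (1 / (m : ℝ)) * ∑ j, u' (-z j - t) ≤ 1}

/-- Sample average approximation estimator of the optimized certainty equivalent risk. -/
def saaOce (u u' : ℝ → ℝ) {m : ℕ} (z : Fin m → ℝ) : ℝ :=
  saaShortfall u' z + (1 / (m : ℝ)) * ∑ j, u (-z j - saaShortfall u' z)

end

/-! Let μ be the law of X, ν the empirical measure and t = SR(X). The objective s ↦ s + ∫ u(-x-s) dμ
has 1 - ∫ u'(-x-s) dμ as a subgradient, so the shortfall risk minimises it, for μ and equally for ν
(`oceObjective_shortfallRisk_le`). The error is then bounded separately from each side.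

From above: testing the empirical infimum at t bounds OCE_m - OCE by the sample mean of u(-Z_j-t)
minus its expectation, whose second moment is at most σ₃²/m.

From below: integrate the tangent inequality of u along the monotone (quantile) coupling of μ and ν.
Since ∫ u'(-x-t) dμ = 1, the shifts cancel and the deficit is at most ∫ u'(-Q_μ-t)(Q_ν-Q_μ)⁺ dp
(`ofReal_oceObjective_sub_le`). The weight is only in L², with second moment at most σ² = σ₂²+1, but
it decreases in p. Slicing over levels ξ, its mean over (F_ν, F_μ] is at most its mean over (0,
F_μ), so Cauchy–Schwarz bounds each slice by σ(F_μ-F_ν)⁺/√F_μ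
(`setLIntegral_Ioc_le_transportBound`). The second moment of a slice is at most σ² min(F_μ,
(1-F_μ)/m). Fourth-moment decay and Cauchy–Schwarz in ξ with weight R²+ξ², R = T m^{1/4}, give order
σ²T²/√m (`lintegral_sq_lintegral_transportBound_le`). -/

noncomputable section

open Filter Topology

/-! ### Subgradient inequality for `u`. -/

namespace IsUtility

variable {u u' : ℝ → ℝ}

lemma continuous (hu : IsUtility u u') : Continuous u := by
  rw [← continuousOn_univ]
  exact hu.convex.continuousOn isOpen_univ

lemma frequently_differentiableAt (hu : IsUtility u u') {a b : ℝ} (hab : a < b) :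
    ∃ x ∈ Set.Ioo a b, DifferentiableAt ℝ u x := by
  by_contra! h
  have h0 : volume (Set.Ioo a b) = 0 :=
    measure_mono_null (fun x hx => fun hd => h x hx hd.1) hu.ae_contDiff
  simp at h0
  linarith

/-- At a point of differentiability, `u` lies above its tangent. -/
lemma add_mul_sub_le_of_differentiableAt (hu : IsUtility u u') {a : ℝ}
    (ha : DifferentiableAt ℝ u a) (b : ℝ) : u a + u' a * (b - a) ≤ u b := by
  have hd := hu.hasDerivAt a ha
  rcases lt_trichotomy a b with hab | rfl | hab
  · have := hu.convex.le_slope_of_hasDerivAt (Set.mem_univ a) (Set.mem_univ b) hab hd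
    rw [slope_def_field, le_div_iff₀ (by linarith)] at this
    linarith
  · simp
  · have := hu.convex.slope_le_of_hasDerivAt (Set.mem_univ b) (Set.mem_univ a) hab hd
    rw [slope_def_field, div_le_iff₀ (by linarith)] at this
    linarith

/-- `u'` selects a subgradient of `u` at every point. -/
lemma add_mul_sub_le (hu : IsUtility u u') (a b : ℝ) : u a + u' a * (b - a) ≤ u b := by
  have hcont : Tendsto (fun x => u x + u' a * (b - x)) (𝓝 a) (𝓝 (u a + u' a * (b - a))) :=
    ((hu.continuous.add (continuous_const.mul (continuous_const.sub continuous_id))).tendsto a)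
  refine le_of_forall_pos_le_add fun ε hε => ?_
  have hev := hcont.eventually (lt_mem_nhds (show u a + u' a * (b - a) - ε < _ by linarith))
  obtain ⟨δ, hδ, hball⟩ := Metric.eventually_nhds_iff.1 hev
  rcases lt_trichotomy a b with hab | rfl | hab
  -- The tangent at a differentiability point x just right of a has slope at least `u' a`;
  -- continuity of `u` makes moving the base point from a to x cost at most ε.
  · obtain ⟨x, hx, hd⟩ := hu.frequently_differentiableAt (show a < min b (a + δ) by simp [hab, hδ])
    have hxb := hx.2.trans_le (min_le_left _ _)
    have hxδ := hx.2.trans_le (min_le_right _ _)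
    have h1 := hball (y := x) (by rw [Real.dist_eq, abs_lt]; constructor <;> linarith [hx.1])
    have h2 := hu.add_mul_sub_le_of_differentiableAt hd b
    have h3 := mul_le_mul_of_nonneg_right (hu.deriv_mono hx.1.le) (show 0 ≤ b - x by linarith)
    linarith
  · simp [hε.le]
  · obtain ⟨x, hx, hd⟩ := hu.frequently_differentiableAt (show max b (a - δ) < a by simp [hab, hδ])
    have hxb := (le_max_left _ _).trans_lt hx.1
    have hxδ := (le_max_right _ _).trans_lt hx.1
    have h1 := hball (y := x) (by rw [Real.dist_eq, abs_lt]; constructor <;> linarith [hx.2])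
    have h2 := hu.add_mul_sub_le_of_differentiableAt hd b
    have h3 := mul_le_mul_of_nonneg_right (hu.deriv_mono hx.2.le) (show 0 ≤ x - b by linarith)
    linarith

lemma deriv_nonneg (hu : IsUtility u u') (a : ℝ) : 0 ≤ u' a := by
  have h1 := hu.add_mul_sub_le a (a - 1)
  have h2 := hu.mono (show a - 1 ≤ a by linarith)
  linarith

lemma measurable_deriv (hu : IsUtility u u') : Measurable u' := hu.deriv_mono.measurable

end IsUtility

/-! ### Minimising the objective. -/

/-- The objective whose infimum over `t` is the optimized certainty equivalent of `μ`. -/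
def oceObjective (u : ℝ → ℝ) (μ : Measure ℝ) (t : ℝ) : ℝ := t + ∫ x, u (-x - t) ∂μ

section Minimizer

variable {u u' : ℝ → ℝ} {μ : Measure ℝ}

/-- Integrating the pointwise subgradient inequality yields a subgradient of the objective without
differentiating under the integral. -/
lemma oceObjective_add_mul_sub_le [IsProbabilityMeasure μ] (hu : IsUtility u u')
    (h : ∀ t, Integrable (fun x => u (-x - t)) μ) (h' : ∀ t, Integrable (fun x => u' (-x - t)) μ)
    (a b : ℝ) :
    oceObjective u μ a + (1 - ∫ x, u' (-x - a) ∂μ) * (b - a) ≤ oceObjective u μ b := by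
  have key : ∫ x, (u (-x - a) + u' (-x - a) * (a - b)) ∂μ ≤ ∫ x, u (-x - b) ∂μ := by
    refine integral_mono ((h a).add ((h' a).mul_const _)) (h b) fun x => ?_
    have := hu.add_mul_sub_le (-x - a) (-x - b)
    rw [show -x - b - (-x - a) = a - b by ring] at this
    exact this
  rw [integral_add (h a) ((h' a).mul_const _), integral_mul_const] at key
  unfold oceObjective
  linarith

/-- Only a value below 1 is needed, not the limit of `u'` at -∞. Truncating from below at `u' a`
makes the integrand eventually constant in t for each x, so dominated convergence applies. -/
lemma tendsto_integral_deriv_atTop (hu : IsUtility u u') [IsProbabilityMeasure μ]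
    (h' : ∀ t, Integrable (fun x => u' (-x - t)) μ) (a : ℝ) :
    Tendsto (fun t => ∫ x, max (u' (-x - t)) (u' a) ∂μ) atTop (𝓝 (u' a)) := by
  have : Tendsto (fun t => ∫ x, max (u' (-x - t)) (u' a) ∂μ) atTop (𝓝 (∫ _, u' a ∂μ)) := by
    refine tendsto_integral_filter_of_dominated_convergence (fun x => |u' (-x - 0)| + |u' a|)
      (Eventually.of_forall fun t => ((h' t).aestronglyMeasurable.sup aestronglyMeasurable_const))
      ?_ ((h' 0).abs.add (integrable_const _)) (Eventually.of_forall fun x => ?_)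
    · filter_upwards [eventually_ge_atTop 0] with t ht
      refine Eventually.of_forall fun x => ?_
      rw [Real.norm_eq_abs, abs_of_nonneg (le_max_of_le_right (hu.deriv_nonneg a))]
      have := hu.deriv_mono (show -x - t ≤ -x - 0 by linarith)
      refine max_le ?_ ?_ <;> linarith [le_abs_self (u' (-x - 0)), le_abs_self (u' a),
        abs_nonneg (u' (-x - 0)), abs_nonneg (u' a)]
    · refine tendsto_const_nhds.congr' ?_
      filter_upwards [eventually_ge_atTop (-x - a)] with t ht
      exact (max_eq_right (hu.deriv_mono (by linarith))).symm
  simpa using this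

lemma tendsto_integral_deriv_atBot (hu : IsUtility u u') [IsProbabilityMeasure μ]
    (h' : ∀ t, Integrable (fun x => u' (-x - t)) μ) (b : ℝ) :
    Tendsto (fun t => ∫ x, min (u' (-x - t)) (u' b) ∂μ) atBot (𝓝 (u' b)) := by
  have : Tendsto (fun t => ∫ x, min (u' (-x - t)) (u' b) ∂μ) atBot (𝓝 (∫ _, u' b ∂μ)) := by
    refine tendsto_integral_filter_of_dominated_convergence (fun _ => u' b)
      (Eventually.of_forall fun t => ((h' t).aestronglyMeasurable.inf aestronglyMeasurable_const))
      (Eventually.of_forall fun t => Eventually.of_forall fun x => ?_) (integrable_const _)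
      (Eventually.of_forall fun x => ?_)
    · rw [Real.norm_eq_abs, abs_of_nonneg (le_min (hu.deriv_nonneg _) (hu.deriv_nonneg b))]
      exact min_le_right _ _
    · refine tendsto_const_nhds.congr' ?_
      filter_upwards [eventually_le_atBot (-x - b)] with t ht
      exact (min_eq_right (hu.deriv_mono (by linarith))).symm
  simpa using this

lemma antitone_integral_deriv (hu : IsUtility u u')
    (h' : ∀ t, Integrable (fun x => u' (-x - t)) μ) : Antitone fun t => ∫ x, u' (-x - t) ∂μ :=
  fun s t hst => integral_mono (h' t) (h' s) fun x => hu.deriv_mono (by linarith)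

lemma shortfall_set_nonempty (hu : IsUtility u u') [IsProbabilityMeasure μ]
    (h' : ∀ t, Integrable (fun x => u' (-x - t)) μ) :
    {t : ℝ | ∫ x, u' (-x - t) ∂μ ≤ 1}.Nonempty := by
  obtain ⟨a, ha⟩ := hu.exists_lt_one
  obtain ⟨t, ht⟩ := ((tendsto_integral_deriv_atTop hu h' a).eventually_lt_const ha).exists
  refine ⟨t, le_trans (integral_mono (h' t) ((h' t).sup (integrable_const _)) fun x => ?_) ht.le⟩
  exact le_max_left _ _

lemma shortfall_set_bddBelow (hu : IsUtility u u') [IsProbabilityMeasure μ]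
    (h' : ∀ t, Integrable (fun x => u' (-x - t)) μ) :
    BddBelow {t : ℝ | ∫ x, u' (-x - t) ∂μ ≤ 1} := by
  obtain ⟨b, hb⟩ := hu.exists_one_lt
  obtain ⟨t, ht⟩ := ((tendsto_integral_deriv_atBot hu h' b).eventually_const_lt hb).exists
  refine ⟨t, fun s hs => ?_⟩
  by_contra! hst
  have h1 : ∫ x, min (u' (-x - t)) (u' b) ∂μ ≤ ∫ x, u' (-x - t) ∂μ :=
    integral_mono ((h' t).inf (integrable_const _)) (h' t) fun x => min_le_left _ _
  have h2 := antitone_integral_deriv hu h' hst.le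
  rw [Set.mem_ofPred_eq] at hs
  linarith

/-- The shortfall risk for the loss `u'` minimises the objective of the certainty equivalent. -/
lemma oceObjective_shortfallRisk_le (hu : IsUtility u u') [IsProbabilityMeasure μ]
    (h : ∀ t, Integrable (fun x => u (-x - t)) μ) (h' : ∀ t, Integrable (fun x => u' (-x - t)) μ)
    (t : ℝ) : oceObjective u μ (shortfallRisk u' 1 id μ) ≤ oceObjective u μ t := by
  set s := shortfallRisk u' 1 id μ with hs
  have hsub := oceObjective_add_mul_sub_le hu h h'
  set g : ℝ → ℝ := fun t => ∫ x, u' (-x - t) ∂μ with hg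
  have hne : {t | g t ≤ 1}.Nonempty := shortfall_set_nonempty hu h'
  have hbdd : BddBelow {t | g t ≤ 1} := shortfall_set_bddBelow hu h'
  have hs' : s = sInf {t | g t ≤ 1} := rfl
  have hlim : Tendsto (fun x => oceObjective u μ s + (1 - g s) * (x - s)) (𝓝 s)
      (𝓝 (oceObjective u μ s)) := by
    have : Continuous fun x => oceObjective u μ s + (1 - g s) * (x - s) := by fun_prop
    simpa using this.tendsto s
  -- The infimum s need not satisfy the constraint, since g may jump there. So s is approached by
  -- points r: from the left, where g r > 1, or from the right within the constraint set. The sign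
  -- of 1 - g r compares r with t, and the subgradient at s compares s with r up to a vanishing
  -- term.
  rcases lt_trichotomy t s with hts | rfl | hst
  · refine le_of_tendsto (hlim.mono_left (nhdsWithin_le_nhds (s := Set.Iio s))) ?_
    filter_upwards [Ioo_mem_nhdsLT hts] with r hr
    have hgr : 1 < g r := by
      by_contra! hc
      exact absurd (csInf_le hbdd hc) (by rw [← hs']; exact not_le.2 hr.2)
    have h1 := hsub r t
    have h2 := hsub s r
    have h3 : 0 ≤ (1 - g r) * (t - r) :=
      mul_nonneg_of_nonpos_of_nonpos (by linarith) (by linarith [hr.1])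
    exact h2.trans (by linarith)
  · exact le_rfl
  · refine le_of_forall_pos_le_add fun ε hε => ?_
    obtain ⟨δ, hδ, hball⟩ := Metric.eventually_nhds_iff.1
      (hlim.eventually (lt_mem_nhds (show oceObjective u μ s - ε < _ by linarith)))
    obtain ⟨r, hr, hrlt⟩ := exists_lt_of_csInf_lt hne
      (show sInf {t | g t ≤ 1} < min t (s + δ) by rw [← hs']; simp [hst, hδ])
    have hsr : s ≤ r := hs' ▸ csInf_le hbdd hr
    have h0 := hball (y := r) (by
      rw [Real.dist_eq, abs_lt]
      constructor <;> linarith [hrlt.trans_le (min_le_right t (s + δ))])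
    have h1 := hsub r t
    have h2 := hsub s r
    have h3 : 0 ≤ (1 - g r) * (t - r) :=
      mul_nonneg (by simpa using hr) (by linarith [hrlt.trans_le (min_le_left t (s + δ))])
    have h4 : oceObjective u μ r + (1 - g r) * (t - r) ≤ oceObjective u μ t := h1
    have h5 : oceObjective u μ s + (1 - g s) * (r - s) ≤ oceObjective u μ r := h2
    linarith

lemma oceRisk_id_eq (hu : IsUtility u u') [IsProbabilityMeasure μ]
    (h : ∀ t, Integrable (fun x => u (-x - t)) μ) (h' : ∀ t, Integrable (fun x => u' (-x - t)) μ) :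
    oceRisk u id μ = oceObjective u μ (shortfallRisk u' 1 id μ) := by
  have hmin := oceObjective_shortfallRisk_le hu h h'
  exact le_antisymm (ciInf_le ⟨_, Set.forall_mem_range.2 hmin⟩ _) (le_ciInf hmin)

/-- If almost every translate of `u'` is continuous, then the shortfall constraint is active. -/
lemma integral_deriv_shortfallRisk (hu : IsUtility u u') [IsProbabilityMeasure μ]
    (h' : ∀ t, Integrable (fun x => u' (-x - t)) μ)
    (hc : ∀ t, ∀ᵐ x ∂μ, ContinuousAt u' (-x - t)) :
    ∫ x, u' (-x - shortfallRisk u' 1 id μ) ∂μ = 1 := by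
  set s := shortfallRisk u' 1 id μ
  set g : ℝ → ℝ := fun t => ∫ x, u' (-x - t) ∂μ with hg
  have hne : {t | g t ≤ 1}.Nonempty := shortfall_set_nonempty hu h'
  have hbdd : BddBelow {t | g t ≤ 1} := shortfall_set_bddBelow hu h'
  have hs' : s = sInf {t | g t ≤ 1} := rfl
  have hgc : Continuous g := by
    refine continuous_iff_continuousAt.2 fun t => ?_
    refine tendsto_integral_filter_of_dominated_convergence (fun x => u' (-x - (t - 1)))
      (Eventually.of_forall fun r => (h' r).aestronglyMeasurable) ?_ (h' _) ?_
    · filter_upwards [lt_mem_nhds (show t - 1 < t by linarith)] with r hr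
      refine Eventually.of_forall fun x => ?_
      rw [Real.norm_eq_abs, abs_of_nonneg (hu.deriv_nonneg _)]
      exact hu.deriv_mono (by linarith)
    · filter_upwards [hc t] with x hx
      have h2 : Tendsto (fun r : ℝ => -x - r) (𝓝 t) (𝓝 (-x - t)) :=
        (continuous_const.sub continuous_id).tendsto t
      exact hx.tendsto.comp h2
  have hmem : g s ≤ 1 := (isClosed_le hgc continuous_const).csInf_mem hne hbdd
  refine le_antisymm hmem ?_
  refine ge_of_tendsto ((hgc.tendsto s).mono_left (nhdsWithin_le_nhds (s := Set.Iio s))) ?_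
  filter_upwards [self_mem_nhdsWithin] with r hr
  by_contra! hcon
  exact absurd (csInf_le hbdd (show r ∈ {t | g t ≤ 1} from hcon.le)) (not_le.2 hr)

/-- Either `u'` is the continuous derivative of `u`, or μ has no atoms and so ignores the countably
many jumps of the monotone `u'`. -/
lemma ae_continuousAt_deriv (hu : IsUtility u u') [IsProbabilityMeasure μ]
    (hAB : ContDiff ℝ 1 u ∨ Continuous (fun x : ℝ => cdf μ x)) (t : ℝ) :
    ∀ᵐ x ∂μ, ContinuousAt u' (-x - t) := by
  rcases hAB with hA | hB
  · have hd : u' = deriv u := funext fun x =>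
      ((hu.hasDerivAt x (hA.differentiable one_ne_zero x)).deriv).symm
    exact Eventually.of_forall fun x => hd ▸ (hA.continuous_deriv le_rfl).continuousAt
  · have hcount : {x : ℝ | ¬ ContinuousAt u' (-x - t)}.Countable := by
      refine hu.deriv_mono.countable_not_continuousAt.preimage (f := fun x : ℝ => -x - t) ?_
      exact fun x y hxy => by simpa using hxy
    have hatom : NullSingletonClass μ := ⟨fun x => by
      rw [← measure_cdf μ, StieltjesFunction.measure_singleton,
        hB.continuousAt.continuousWithinAt.leftLim_eq]
      simp⟩
    exact hcount.measure_zero μ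

end Minimizer

/-! ### Quantile coupling and the weighted transport bound. -/

/-- The quantile function of a probability measure on the real line. -/
def quantile (μ : Measure ℝ) (p : ℝ) : ℝ := sInf {x | p ≤ cdf μ x}

section Quantile

variable {μ ν : Measure ℝ}

/-- Right continuity of the cdf makes the infimum attained; 0 < p < 1 makes the set bounded below
and nonempty. -/
lemma quantile_le_iff {p : ℝ} (hp : p ∈ Set.Ioo (0 : ℝ) 1) (x : ℝ) :
    quantile μ p ≤ x ↔ p ≤ cdf μ x := by
  have hne : {x | p ≤ cdf μ x}.Nonempty := by
    obtain ⟨y, hy⟩ := ((tendsto_cdf_atTop μ).eventually_const_lt hp.2).exists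
    exact ⟨y, hy.le⟩
  have hbdd : BddBelow {x | p ≤ cdf μ x} := by
    obtain ⟨y, hy⟩ := ((tendsto_cdf_atBot μ).eventually_lt_const hp.1).exists
    refine ⟨y, fun z hz => ?_⟩
    by_contra! hzy
    exact absurd (monotone_cdf μ hzy.le) (not_le.2 (hy.trans_le hz))
  refine ⟨fun h => ?_, fun h => csInf_le hbdd h⟩
  refine ge_of_tendsto ((cdf μ).right_continuous x |>.mono_left
    (nhdsWithin_mono x Set.Ioi_subset_Ici_self)) ?_
  filter_upwards [self_mem_nhdsWithin] with y hy
  obtain ⟨z, hz, hzy⟩ := exists_lt_of_csInf_lt hne (lt_of_le_of_lt h hy)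
  exact le_trans hz (monotone_cdf μ hzy.le)

lemma monotoneOn_quantile : MonotoneOn (quantile μ) (Set.Ioo 0 1) := fun _ ha _ hb hab =>
  (quantile_le_iff ha _).2 (hab.trans ((quantile_le_iff hb _).1 le_rfl))

lemma aemeasurable_quantile : AEMeasurable (quantile μ) (volume.restrict (Set.Ioo 0 1)) :=
  aemeasurable_restrict_of_monotoneOn measurableSet_Ioo monotoneOn_quantile

instance : IsProbabilityMeasure (volume.restrict (Set.Ioo (0 : ℝ) 1)) := ⟨by simp⟩

lemma map_quantile [IsProbabilityMeasure μ] :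
    (volume.restrict (Set.Ioo (0 : ℝ) 1)).map (quantile μ) = μ := by
  have := Measure.isProbabilityMeasure_map (aemeasurable_quantile (μ := μ))
  refine Measure.ext_of_Iic _ _ fun x => ?_
  rw [Measure.map_apply_of_aemeasurable aemeasurable_quantile measurableSet_Iic, ← ofReal_cdf,
    Measure.restrict_apply₀' measurableSet_Ioo.nullMeasurableSet]
  have hset : quantile μ ⁻¹' Set.Iic x ∩ Set.Ioo 0 1 = Set.Ioo 0 1 ∩ Set.Iic (cdf μ x) := by
    ext p
    simp only [Set.mem_inter_iff, Set.mem_preimage, Set.mem_Iic]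
    constructor
    · rintro ⟨h, hp⟩
      exact ⟨hp, (quantile_le_iff hp x).1 h⟩
    · rintro ⟨hp, h⟩
      exact ⟨(quantile_le_iff hp x).2 h, hp⟩
  rw [hset]
  refine le_antisymm ?_ ?_
  · refine (measure_mono (t := Set.Ioc 0 (cdf μ x)) fun p hp => ⟨hp.1.1, hp.2⟩).trans ?_
    simp
  · refine le_trans ?_ (measure_mono (s := Set.Ioo 0 (cdf μ x)) fun p hp =>
      ⟨⟨hp.1, hp.2.trans_le (cdf_le_one μ x)⟩, hp.2.le⟩)
    simp

/-- The average of an antitone function over a final segment of an interval is at most its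
average over the interval. -/
lemma mul_setLIntegral_Ioo_le {Q : ℝ → ENNReal} {a b : ℝ} (ha : 0 ≤ a) (hab : a < b)
    (hQ : AntitoneOn Q (Set.Ioo 0 b)) :
    ENNReal.ofReal b * ∫⁻ p in Set.Ioo a b, Q p ≤
      ENNReal.ofReal (b - a) * ∫⁻ p in Set.Ioo 0 b, Q p := by
  rcases ha.eq_or_lt with rfl | ha
  · simp
  have h1 : ∫⁻ p in Set.Ioo a b, Q p ≤ ENNReal.ofReal (b - a) * Q a := by
    calc ∫⁻ p in Set.Ioo a b, Q p ≤ ∫⁻ _ in Set.Ioo a b, Q a :=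
          setLIntegral_mono' measurableSet_Ioo fun p hp =>
            hQ ⟨ha, hab⟩ ⟨ha.trans hp.1, hp.2⟩ hp.1.le
      _ = _ := by simp [mul_comm]
  have h2 : ENNReal.ofReal a * Q a ≤ ∫⁻ p in Set.Ioc 0 a, Q p := by
    calc ENNReal.ofReal a * Q a = ∫⁻ _ in Set.Ioc 0 a, Q a := by simp [mul_comm]
      _ ≤ _ := setLIntegral_mono' measurableSet_Ioc fun p hp =>
            hQ ⟨hp.1, hp.2.trans_lt hab⟩ ⟨ha, hab⟩ hp.2
  have hsplit : ∫⁻ p in Set.Ioo 0 b, Q p = (∫⁻ p in Set.Ioc 0 a, Q p) + ∫⁻ p in Set.Ioo a b, Q p := by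
    rw [← Set.Ioc_union_Ioo_eq_Ioo ha.le hab, lintegral_union measurableSet_Ioo]
    exact Set.disjoint_left.2 fun p hp hp' => not_lt.2 hp.2 hp'.1
  have hb : ENNReal.ofReal b = ENNReal.ofReal a + ENNReal.ofReal (b - a) := by
    rw [← ENNReal.ofReal_add ha.le (by linarith)]
    congr 1
    ring
  rw [hsplit, hb, add_mul, mul_add]
  -- After cancelling the common term, both sides are compared through `Q a`, which bounds `Q` from
  -- above to the right of a and from below to its left.
  refine add_le_add_left ?_ _
  calc ENNReal.ofReal a * ∫⁻ p in Set.Ioo a b, Q p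
      ≤ ENNReal.ofReal a * (ENNReal.ofReal (b - a) * Q a) := by gcongr
    _ = ENNReal.ofReal (b - a) * (ENNReal.ofReal a * Q a) := by ring
    _ ≤ _ := by gcongr

lemma lintegral_mul_self_le {α : Type*} [MeasurableSpace α] (μ : Measure α) {f g : α → ENNReal}
    (hf : AEMeasurable f μ) (hg : AEMeasurable g μ) :
    (∫⁻ x, f x * g x ∂μ) ^ 2 ≤ (∫⁻ x, f x ^ 2 ∂μ) * ∫⁻ x, g x ^ 2 ∂μ := by
  have h := ENNReal.lintegral_mul_le_Lp_mul_Lq μ Real.HolderConjugate.two_two hf hg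
  calc (∫⁻ x, f x * g x ∂μ) ^ 2 ≤ ((∫⁻ x, f x ^ (2 : ℝ) ∂μ) ^ (1 / (2 : ℝ)) *
        (∫⁻ x, g x ^ (2 : ℝ) ∂μ) ^ (1 / (2 : ℝ))) ^ 2 := by gcongr; exact h
    _ = _ := by
      rw [mul_pow, ← ENNReal.rpow_natCast, ← ENNReal.rpow_natCast, ← ENNReal.rpow_mul,
        ← ENNReal.rpow_mul]
      norm_num

/-- Bound for the weighted mass transported across the level `ξ` by the monotone coupling. -/
def transportBound (σ : ℝ) (μ ν : Measure ℝ) (ξ : ℝ) : ℝ :=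
  σ * (max (cdf μ ξ - cdf ν ξ) 0 / √(cdf μ ξ))

/-- With p = F_μ(ξ) and a = F_ν(ξ), monotonicity bounds the integral over (a, p) by the fraction
(p-a)/p of the integral over (0, p), which is at most √p σ by Cauchy–Schwarz. -/
lemma setLIntegral_Ioc_le_transportBound {Q : ℝ → ENNReal} {σ : ℝ} (hσ : 0 ≤ σ)
    (hQm : AEMeasurable Q (volume.restrict (Set.Ioo 0 1)))
    (hQ : AntitoneOn Q (Set.Ioo 0 1))
    (hQσ : ∫⁻ p in Set.Ioo 0 1, Q p ^ 2 ≤ ENNReal.ofReal (σ ^ 2)) (ξ : ℝ) :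
    ∫⁻ p in Set.Ioo 0 1 ∩ Set.Ioc (cdf ν ξ) (cdf μ ξ), Q p ≤
      ENNReal.ofReal (transportBound σ μ ν ξ) := by
  set p := cdf μ ξ
  set a := cdf ν ξ
  rcases le_or_gt p a with hpa | hap
  · simp [Set.Ioc_eq_empty (not_lt.2 hpa)]
  have ha : 0 ≤ a := cdf_nonneg ν ξ
  have hp : 0 < p := ha.trans_lt hap
  have hp1 : p ≤ 1 := cdf_le_one μ ξ
  have hsub : Set.Ioo 0 p ⊆ Set.Ioo 0 1 := Set.Ioo_subset_Ioo_right hp1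
  have hJ : (∫⁻ r in Set.Ioo 0 p, Q r) ^ 2 ≤ ENNReal.ofReal (√p * σ) ^ 2 := by
    have h := lintegral_mul_self_le (volume.restrict (Set.Ioo 0 p)) (f := fun _ => 1) (g := Q)
      aemeasurable_const (hQm.mono_measure (Measure.restrict_mono_set _ hsub))
    simp only [one_mul, one_pow, lintegral_const, Measure.restrict_apply_univ, Real.volume_Ioo,
      sub_zero] at h
    refine h.trans ?_
    rw [← ENNReal.ofReal_pow (by positivity), mul_pow, Real.sq_sqrt hp.le,
      ENNReal.ofReal_mul hp.le]
    gcongr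
    exact (lintegral_mono_set hsub).trans hQσ
  have hJ' : ∫⁻ r in Set.Ioo 0 p, Q r ≤ ENNReal.ofReal (√p * σ) :=
    (ENNReal.pow_le_pow_left_iff two_ne_zero).1 hJ
  have havg := mul_setLIntegral_Ioo_le ha hap (hQ.mono hsub)
  have hI : ∫⁻ r in Set.Ioo 0 1 ∩ Set.Ioc a p, Q r ≤ ∫⁻ r in Set.Ioo a p, Q r := by
    rw [Measure.restrict_congr_set Ioo_ae_eq_Ioc]
    exact lintegral_mono_set Set.inter_subset_right
  refine hI.trans ?_
  have hval : transportBound σ μ ν ξ = (p - a) * (√p * σ) / p := by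
    have : √p * √p = p := Real.mul_self_sqrt hp.le
    have h0 : √p ≠ 0 := (Real.sqrt_pos.2 hp).ne'
    rw [transportBound, max_eq_left (by linarith)]
    change σ * ((p - a) / √p) = _
    rw [eq_div_iff hp.ne']
    calc σ * ((p - a) / √p) * p = σ * ((p - a) / √p) * (√p * √p) := by rw [this]
      _ = _ := by field_simp
  rw [hval, ENNReal.ofReal_div_of_pos hp, ENNReal.ofReal_mul (by linarith),
    ENNReal.le_div_iff_mul_le (by simp [hp]) (by simp), mul_comm]
  exact havg.trans (by gcongr)

/-- Transport bound for the monotone coupling of `μ` and `ν`, weighted by an antitone function. -/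
lemma lintegral_quantile_sub_le [IsProbabilityMeasure μ] {q : ℝ → ℝ} {σ : ℝ} (hσ : 0 ≤ σ)
    (hq : Antitone q) (hqσ : ∫⁻ x, ENNReal.ofReal (q x) ^ 2 ∂μ ≤ ENNReal.ofReal (σ ^ 2)) :
    ∫⁻ p in Set.Ioo 0 1, ENNReal.ofReal (q (quantile μ p)) *
        ENNReal.ofReal (quantile ν p - quantile μ p) ≤
      ∫⁻ ξ, ENNReal.ofReal (transportBound σ μ ν ξ) := by
  set Q : ℝ → ENNReal := fun p => ENNReal.ofReal (q (quantile μ p)) with hQdef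
  have hqm : Measurable fun x => ENNReal.ofReal (q x) := hq.measurable.ennreal_ofReal
  have hQm : AEMeasurable Q (volume.restrict (Set.Ioo 0 1)) :=
    hqm.comp_aemeasurable aemeasurable_quantile
  have hQ : AntitoneOn Q (Set.Ioo 0 1) := fun a ha b hb hab =>
    ENNReal.ofReal_le_ofReal (hq (monotoneOn_quantile ha hb hab))
  have hQσ : ∫⁻ p in Set.Ioo 0 1, Q p ^ 2 ≤ ENNReal.ofReal (σ ^ 2) := by
    refine le_trans (le_of_eq ?_) hqσ
    conv_rhs => rw [← map_quantile (μ := μ)]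
    rw [lintegral_map' (hqm.pow_const 2).aemeasurable aemeasurable_quantile]
  -- Layer-cake: (Q_ν(p)-Q_μ(p))⁺ is the length of the set of ξ with Q_μ(p) ≤ ξ < Q_ν(p), that is
  -- F_ν(ξ) < p ≤ F_μ(ξ). Tonelli then slices by ξ.
  set S : Set (ℝ × ℝ) := {x | cdf ν x.2 < x.1 ∧ x.1 ≤ cdf μ x.2} with hS
  have hSm : MeasurableSet S :=
    (measurableSet_lt ((monotone_cdf ν).measurable.comp measurable_snd) measurable_fst).inter
      (measurableSet_le measurable_fst ((monotone_cdf μ).measurable.comp measurable_snd))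
  have hstep : ∀ p ∈ Set.Ioo (0 : ℝ) 1, Q p * ENNReal.ofReal (quantile ν p - quantile μ p) =
      ∫⁻ ξ, S.indicator (fun x => Q x.1) (p, ξ) := by
    intro p hp
    have : ∀ ξ, S.indicator (fun x => Q x.1) (p, ξ) =
        (Set.Ico (quantile μ p) (quantile ν p)).indicator (fun _ => Q p) ξ := by
      intro ξ
      simp only [Set.indicator, Set.mem_Ico]
      congr 1
      rw [hS, Set.mem_ofPred_eq, quantile_le_iff hp, ← not_le, ← not_le, quantile_le_iff hp,
        and_comm]
    simp_rw [this]
    rw [lintegral_indicator measurableSet_Ico]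
    simp
  rw [setLIntegral_congr_fun measurableSet_Ioo hstep, lintegral_lintegral_swap]
  · refine lintegral_mono fun ξ => ?_
    refine le_trans (le_of_eq ?_)
      (setLIntegral_Ioc_le_transportBound (μ := μ) (ν := ν) hσ hQm hQ hQσ ξ)
    have : ∀ p, S.indicator (fun x => Q x.1) (p, ξ) =
        (Set.Ioc (cdf ν ξ) (cdf μ ξ)).indicator Q p := fun p => rfl
    simp_rw [this]
    rw [lintegral_indicator measurableSet_Ioc, Measure.restrict_restrict measurableSet_Ioc,
      Set.inter_comm]
  · exact (hQm.comp_fst (ν := volume)).indicator hSm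

end Quantile

/-! ### Empirical measures and sample means. -/

/-- The empirical measure of a finite sample. -/
def empiricalMeasure {m : ℕ} (z : Fin m → ℝ) : Measure ℝ :=
  (m : ENNReal)⁻¹ • ∑ j, Measure.dirac (z j)

section Empirical

variable {m : ℕ}

lemma isProbabilityMeasure_empiricalMeasure (hm : 1 ≤ m) (z : Fin m → ℝ) :
    IsProbabilityMeasure (empiricalMeasure z) := ⟨by
  have : (m : ENNReal) ≠ 0 := by simp; omega
  simp [empiricalMeasure, ENNReal.inv_mul_cancel this]⟩

lemma integrable_empiricalMeasure (hm : 1 ≤ m) (z : Fin m → ℝ) (f : ℝ → ℝ) :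
    Integrable f (empiricalMeasure z) := by
  refine Integrable.smul_measure ?_ (by simp; omega)
  exact integrable_finsetSum_measure.2 fun j _ => integrable_dirac (by simp)

lemma integral_empiricalMeasure (z : Fin m → ℝ) (f : ℝ → ℝ) :
    ∫ x, f x ∂(empiricalMeasure z) = (1 / (m : ℝ)) * ∑ j, f (z j) := by
  rw [empiricalMeasure, integral_smul_measure,
    integral_finsetSum_measure fun j _ => integrable_dirac (by simp)]
  simp

lemma saaShortfall_eq (u' : ℝ → ℝ) (z : Fin m → ℝ) :
    saaShortfall u' z = shortfallRisk u' 1 id (empiricalMeasure z) := by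
  simp only [saaShortfall, shortfallRisk, id, integral_empiricalMeasure]

lemma saaOce_eq (u u' : ℝ → ℝ) (z : Fin m → ℝ) :
    saaOce u u' z =
      oceObjective u (empiricalMeasure z) (shortfallRisk u' 1 id (empiricalMeasure z)) := by
  rw [saaOce, oceObjective, integral_empiricalMeasure, saaShortfall_eq]

lemma saaOce_le {u u' : ℝ → ℝ} (hu : IsUtility u u') (hm : 1 ≤ m) (z : Fin m → ℝ) (t : ℝ) :
    saaOce u u' z ≤ t + (1 / (m : ℝ)) * ∑ j, u (-z j - t) := by
  have := isProbabilityMeasure_empiricalMeasure hm z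
  rw [saaOce_eq, ← integral_empiricalMeasure z fun x => u (-x - t)]
  exact oceObjective_shortfallRisk_le hu (fun t => integrable_empiricalMeasure hm z _)
    (fun t => integrable_empiricalMeasure hm z _) t

/-- The estimator is the minimum of an objective continuous in t, hence a countable infimum over
rational t; measurability of the minimiser is never needed. -/
lemma measurable_saaOce {u u' : ℝ → ℝ} (hu : IsUtility u u') (hm : 1 ≤ m) :
    Measurable (saaOce u u' : (Fin m → ℝ) → ℝ) := by
  have hcu := hu.continuous
  have heq : (saaOce u u' : (Fin m → ℝ) → ℝ) =
      fun z => ⨅ t : ℚ, ((t : ℝ) + (1 / (m : ℝ)) * ∑ j, u (-z j - t)) := by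
    funext z
    have hlb := saaOce_le hu hm z
    refine le_antisymm (le_ciInf fun t => hlb t) ?_
    have hcont : Continuous fun t : ℝ => t + (1 / (m : ℝ)) * ∑ j, u (-z j - t) := by fun_prop
    have hall : ∀ t : ℝ, (⨅ t : ℚ, ((t : ℝ) + (1 / (m : ℝ)) * ∑ j, u (-z j - t))) ≤
        t + (1 / (m : ℝ)) * ∑ j, u (-z j - t) := by
      intro t
      refine Rat.denseRange_cast.induction_on t (isClosed_le continuous_const hcont) fun r => ?_
      exact ciInf_le ⟨saaOce u u' z, Set.forall_mem_range.2 fun t : ℚ => hlb t⟩ r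
    exact hall _
  rw [heq]
  exact Measurable.iInf fun t => by fun_prop

lemma cdf_empiricalMeasure (hm : 1 ≤ m) (z : Fin m → ℝ) (ξ : ℝ) :
    cdf (empiricalMeasure z) ξ = (1 / (m : ℝ)) * ∑ j, (Set.Iic ξ).indicator (fun _ => 1) (z j) := by
  have := isProbabilityMeasure_empiricalMeasure hm z
  rw [cdf_eq_real, ← integral_empiricalMeasure z, integral_indicator_const _ measurableSet_Iic]
  simp

lemma measurable_transportBound_empirical (hm : 1 ≤ m) (σ : ℝ) (μ : Measure ℝ) :
    Measurable fun x : (Fin m → ℝ) × ℝ => transportBound σ μ (empiricalMeasure x.1) x.2 := by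
  have hμ : Measurable fun x : (Fin m → ℝ) × ℝ => cdf μ x.2 :=
    (monotone_cdf μ).measurable.comp measurable_snd
  have hν : Measurable fun x : (Fin m → ℝ) × ℝ => cdf (empiricalMeasure x.1) x.2 := by
    simp_rw [cdf_empiricalMeasure hm]
    refine (Finset.measurable_sum _ fun j _ => ?_).const_mul _
    have : (fun x : (Fin m → ℝ) × ℝ => (Set.Iic x.2).indicator (fun _ => (1 : ℝ)) (x.1 j)) =
        {x : (Fin m → ℝ) × ℝ | x.1 j ≤ x.2}.indicator fun _ => 1 := rfl
    rw [this]
    exact measurable_const.indicator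
      (measurableSet_le ((measurable_pi_apply j).comp measurable_fst) measurable_snd)
  unfold transportBound
  exact (((hμ.sub hν).max measurable_const).div hμ.sqrt).const_mul σ

variable {μ : Measure ℝ} [IsProbabilityMeasure μ]

lemma memLp_sampleMean_sub {f : ℝ → ℝ} (hf : MemLp f 2 μ) (c : ℝ) :
    MemLp (fun z : Fin m → ℝ => (1 / (m : ℝ)) * ∑ j, f (z j) - c) 2
      (Measure.pi fun _ : Fin m => μ) := by
  have hsum : MemLp (fun z : Fin m → ℝ => ∑ j, f (z j)) 2 (Measure.pi fun _ : Fin m => μ) :=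
    memLp_finsetSum _ fun j _ =>
      hf.comp_measurePreserving (measurePreserving_eval (fun _ : Fin m => μ) j)
  exact (hsum.const_mul _).sub (memLp_const c)

lemma integral_sampleMean_sub_sq (hm : 1 ≤ m) {f : ℝ → ℝ} (hf : MemLp f 2 μ) :
    ∫ z : Fin m → ℝ, ((1 / (m : ℝ)) * ∑ j, f (z j) - ∫ x, f x ∂μ) ^ 2
      ∂(Measure.pi fun _ => μ) = Var[f; μ] / m := by
  have hm0 : (m : ℝ) ≠ 0 := by positivity
  have hcomp : ∀ j : Fin m, MemLp (fun z : Fin m → ℝ => f (z j)) 2 (Measure.pi fun _ => μ) :=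
    fun j => hf.comp_measurePreserving (measurePreserving_eval (fun _ : Fin m => μ) j)
  have hmean : ∀ j : Fin m, ∫ z : Fin m → ℝ, f (z j) ∂(Measure.pi fun _ => μ) = ∫ x, f x ∂μ := by
    intro j
    have h := measurePreserving_eval (fun _ : Fin m => μ) j
    conv_rhs => rw [← h.map_eq]
    rw [integral_map h.measurable.aemeasurable (by rw [h.map_eq]; exact hf.aestronglyMeasurable)]
  have hE : ∫ z : Fin m → ℝ, (1 / (m : ℝ)) * ∑ j, f (z j) ∂(Measure.pi fun _ => μ) =
      ∫ x, f x ∂μ := by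
    rw [integral_const_mul, integral_finsetSum _ fun j _ => (hcomp j).integrable one_le_two]
    simp_rw [hmean]
    simp
    field_simp
  have hvar := variance_eq_integral (μ := Measure.pi fun _ : Fin m => μ)
    (X := fun z : Fin m → ℝ => (1 / (m : ℝ)) * ∑ j, f (z j))
    ((memLp_finsetSum _ fun j _ => hcomp j).const_mul _).aestronglyMeasurable.aemeasurable
  rw [hE] at hvar
  rw [← hvar, variance_const_mul]
  have hs := variance_sum_pi (μ := fun _ : Fin m => μ) (X := fun _ => f) fun _ => hf
  have heq : (∑ i : Fin m, fun ω : Fin m → ℝ => f (ω i)) = fun ω => ∑ i, f (ω i) := by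
    funext ω
    simp
  rw [heq] at hs
  rw [hs]
  simp
  field_simp

end Empirical

/-! ### Second moment of the transport bound. -/

section Transport

variable {m : ℕ} {μ : Measure ℝ} [IsProbabilityMeasure μ]

lemma memLp_indicator_Iic (ξ : ℝ) : MemLp ((Set.Iic ξ).indicator fun _ => (1 : ℝ)) 2 μ :=
  (memLp_const 1).indicator measurableSet_Iic

lemma integral_indicator_Iic (ξ : ℝ) :
    ∫ x, (Set.Iic ξ).indicator (fun _ => (1 : ℝ)) x ∂μ = cdf μ ξ := by
  rw [integral_indicator_const _ measurableSet_Iic, cdf_eq_real]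
  simp

lemma variance_indicator_Iic (ξ : ℝ) :
    Var[(Set.Iic ξ).indicator fun _ => (1 : ℝ); μ] = cdf μ ξ * (1 - cdf μ ξ) := by
  rw [variance_eq_sub (memLp_indicator_Iic ξ), integral_indicator_Iic]
  have : ((Set.Iic ξ).indicator fun _ => (1 : ℝ)) ^ 2 = (Set.Iic ξ).indicator fun _ => (1 : ℝ) := by
    funext x
    by_cases h : x ∈ Set.Iic ξ <;> simp [h]
  rw [this, integral_indicator_Iic]
  ring

/-- The first bound is deterministic, since (F_μ-F_ν)⁺ ≤ F_μ. The second is the variance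
F_μ(1-F_μ)/m of the empirical cdf, divided by F_μ. -/
lemma lintegral_transportBound_sq_le (hm : 1 ≤ m) (σ ξ : ℝ) :
    ∫⁻ z : Fin m → ℝ, ENNReal.ofReal (transportBound σ μ (empiricalMeasure z) ξ ^ 2)
        ∂(Measure.pi fun _ => μ) ≤
      ENNReal.ofReal (σ ^ 2 * min (cdf μ ξ) ((1 - cdf μ ξ) / m)) := by
  have hp0 := cdf_nonneg μ ξ
  have hp1 := cdf_le_one μ ξ
  set p := cdf μ ξ with hp
  have hm0 : (0 : ℝ) < m := by positivity
  have hsq : ∀ z : Fin m → ℝ, transportBound σ μ (empiricalMeasure z) ξ ^ 2 =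
      σ ^ 2 * (max (p - cdf (empiricalMeasure z) ξ) 0 ^ 2 / p) := fun z => by
    rw [transportBound, mul_pow, div_pow, Real.sq_sqrt hp0]
  rcases hp0.eq_or_lt with h0 | h0
  · simp [hsq, ← h0]
  rw [mul_min_of_nonneg _ _ (sq_nonneg σ), ENNReal.ofReal_min]
  refine le_min ?_ ?_
  · calc _ ≤ ∫⁻ z : Fin m → ℝ, ENNReal.ofReal (σ ^ 2 * p) ∂(Measure.pi fun _ => μ) := by
          refine lintegral_mono fun z => ENNReal.ofReal_le_ofReal ?_
          rw [hsq]
          refine mul_le_mul_of_nonneg_left ?_ (sq_nonneg σ)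
          rw [div_le_iff₀ h0, ← sq]
          exact pow_le_pow_left₀ (le_max_right _ _)
            (max_le (by linarith [cdf_nonneg (empiricalMeasure z) ξ]) hp0) 2
      _ = _ := by simp
  · have hL := memLp_sampleMean_sub (m := m) (memLp_indicator_Iic (μ := μ) ξ) p
    have hV := integral_sampleMean_sub_sq hm (memLp_indicator_Iic (μ := μ) ξ)
    rw [integral_indicator_Iic, variance_indicator_Iic, ← hp] at hV
    calc _ ≤ ∫⁻ z : Fin m → ℝ, ENNReal.ofReal (σ ^ 2 / p * ((1 / (m : ℝ)) *
            ∑ j, (Set.Iic ξ).indicator (fun _ => 1) (z j) - p) ^ 2) ∂(Measure.pi fun _ => μ) := by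
          refine lintegral_mono fun z => ENNReal.ofReal_le_ofReal ?_
          rw [hsq, ← cdf_empiricalMeasure hm, div_mul_eq_mul_div, ← mul_div_assoc]
          refine div_le_div_of_nonneg_right (mul_le_mul_of_nonneg_left ?_ (sq_nonneg σ)) hp0
          rw [sq_le_sq, abs_of_nonneg (le_max_right _ _), abs_sub_comm]
          exact max_le (le_abs_self _) (abs_nonneg _)
      _ = ENNReal.ofReal (σ ^ 2 / p * (p * (1 - p) / m)) := by
          rw [← ofReal_integral_eq_lintegral_ofReal (hL.integrable_sq.const_mul _)
            (Eventually.of_forall fun z => by positivity), integral_const_mul, hV]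
      _ = _ := by
          congr 1
          field_simp

/-- Markov's inequality for the fourth moment: the left tail handles ξ < 0 and the right tail ξ > 0.
-/
lemma cdf_mul_pow_four_le {T : ℝ} (hT : 0 ≤ T) (hX : eLpNorm id 4 μ ≤ ENNReal.ofReal T) {ξ : ℝ}
    (hξ : ξ ≠ 0) : min (cdf μ ξ) (1 - cdf μ ξ) * ξ ^ 4 ≤ T ^ 4 := by
  have hmk := mul_meas_ge_le_pow_eLpNorm' (μ := μ) (f := id) (p := 4) (by norm_num) (by norm_num)
    aestronglyMeasurable_id (ENNReal.ofReal |ξ|)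
  have h4 : (4 : ENNReal).toReal = ((4 : ℕ) : ℝ) := by norm_num
  rw [h4, ENNReal.rpow_natCast, ENNReal.rpow_natCast] at hmk
  set S : Set ℝ := {x | ENNReal.ofReal |ξ| ≤ ‖id x‖ₑ}
  have hS : ∀ x : ℝ, |ξ| ≤ |x| → x ∈ S := fun x hx => by
    change ENNReal.ofReal |ξ| ≤ ‖x‖ₑ
    rw [Real.enorm_eq_ofReal_abs]
    exact ENNReal.ofReal_le_ofReal hx
  have hmin : ENNReal.ofReal (min (cdf μ ξ) (1 - cdf μ ξ)) ≤ μ S := by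
    rcases lt_or_gt_of_ne hξ with h | h
    · refine (ENNReal.ofReal_le_ofReal (min_le_left _ _)).trans ?_
      rw [ofReal_cdf]
      refine measure_mono fun x hx => hS x ?_
      rw [Set.mem_Iic] at hx
      rw [abs_of_neg h, abs_of_neg (hx.trans_lt h)]
      linarith
    · refine (ENNReal.ofReal_le_ofReal (min_le_right _ _)).trans ?_
      have : 1 - cdf μ ξ = μ.real (Set.Ioi ξ) := by
        rw [cdf_eq_real, ← Set.compl_Iic, probReal_compl_eq_one_sub measurableSet_Iic]
      rw [this, ofReal_measureReal]
      refine measure_mono fun x hx => hS x ?_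
      rw [Set.mem_Ioi] at hx
      rw [abs_of_pos h, abs_of_pos (h.trans hx)]
      exact hx.le
  rw [← ENNReal.ofReal_le_ofReal_iff (by positivity), ENNReal.ofReal_mul
    (le_min (cdf_nonneg μ ξ) (by linarith [cdf_le_one μ ξ])), ENNReal.ofReal_pow hT, mul_comm]
  calc ENNReal.ofReal (ξ ^ 4) * ENNReal.ofReal (min (cdf μ ξ) (1 - cdf μ ξ))
      ≤ ENNReal.ofReal |ξ| ^ 4 * μ S := by
        rw [← ENNReal.ofReal_pow (abs_nonneg ξ), Even.pow_abs (by decide)]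
        gcongr
    _ ≤ _ := hmk.trans (by gcongr)

/-- The bound 1/m serves |ξ| ≤ R and the tail bound T⁴/ξ⁴ serves |ξ| > R; R⁴ = mT⁴ is where they
meet. -/
lemma min_cdf_le {T R : ℝ} (hT : 0 ≤ T) (hR : 0 < R) (hm : 1 ≤ m) (hRT : R ^ 4 = m * T ^ 4)
    (hX : eLpNorm id 4 μ ≤ ENNReal.ofReal T) (ξ : ℝ) :
    min (cdf μ ξ) ((1 - cdf μ ξ) / m) ≤ 4 * T ^ 4 / (R ^ 2 + ξ ^ 2) ^ 2 := by
  have hm0 : (1 : ℝ) ≤ m := by exact_mod_cast hm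
  have hp0 := cdf_nonneg μ ξ
  have hp1 := cdf_le_one μ ξ
  set p := cdf μ ξ
  have hle : (1 - p) / m ≤ 1 - p := div_le_self (by linarith) hm0
  have hnn : 0 ≤ min p ((1 - p) / m) := le_min hp0 (div_nonneg (by linarith) (by linarith))
  rw [le_div_iff₀ (by positivity)]
  rcases le_or_gt (ξ ^ 2) (R ^ 2) with h | h
  · have h1 : min p ((1 - p) / m) ≤ 1 / m :=
      (min_le_right _ _).trans (div_le_div_of_nonneg_right (by linarith) (by linarith))
    have h2 : (R ^ 2 + ξ ^ 2) ^ 2 ≤ 4 * R ^ 4 := by nlinarith [sq_nonneg ξ, sq_nonneg R]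
    calc _ ≤ 1 / (m : ℝ) * (4 * R ^ 4) := mul_le_mul h1 h2 (by positivity) (by positivity)
      _ = _ := by rw [hRT]; field_simp
  · have hξ : ξ ≠ 0 := by
      rintro rfl
      nlinarith [sq_nonneg R]
    have h2 : (R ^ 2 + ξ ^ 2) ^ 2 ≤ 4 * ξ ^ 4 := by nlinarith [sq_nonneg ξ, sq_nonneg R]
    have h3 := cdf_mul_pow_four_le hT hX hξ
    calc _ ≤ min p (1 - p) * (4 * ξ ^ 4) :=
          mul_le_mul (min_le_min_left p hle) h2 (by positivity) (le_min hp0 (by linarith))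
      _ ≤ _ := by linarith

lemma lintegral_inv_sq_add_sq {R : ℝ} (hR : 0 < R) :
    ∫⁻ ξ : ℝ, ENNReal.ofReal (R ^ 2 + ξ ^ 2)⁻¹ = ENNReal.ofReal (Real.pi / R) := by
  have heq : ∀ ξ : ℝ, (R ^ 2 + ξ ^ 2)⁻¹ = (R ^ 2)⁻¹ * (1 + (ξ / R) ^ 2)⁻¹ := fun ξ => by
    field_simp
  have hint : Integrable fun ξ : ℝ => (R ^ 2 + ξ ^ 2)⁻¹ := by
    simp_rw [heq]
    exact (integrable_inv_one_add_sq.comp_div hR.ne').const_mul _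
  rw [← ofReal_integral_eq_lintegral_ofReal hint (Eventually.of_forall fun ξ => by positivity)]
  congr 1
  simp_rw [heq]
  rw [integral_const_mul, Measure.integral_comp_div (fun x : ℝ => (1 + x ^ 2)⁻¹),
    integral_univ_inv_one_add_sq, abs_of_pos hR, smul_eq_mul]
  field_simp

/-- Second moment of the transport bound between a distribution and its empirical measure. -/
lemma lintegral_sq_lintegral_transportBound_le {σ T R : ℝ} (hT : 0 ≤ T) (hR : 0 < R)
    (hm : 1 ≤ m) (hRT : R ^ 4 = m * T ^ 4) (hX : eLpNorm id 4 μ ≤ ENNReal.ofReal T) :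
    ∫⁻ z : Fin m → ℝ, (∫⁻ ξ, ENNReal.ofReal (transportBound σ μ (empiricalMeasure z) ξ)) ^ 2
        ∂(Measure.pi fun _ => μ) ≤
      ENNReal.ofReal (4 * Real.pi ^ 2 * σ ^ 2 * T ^ 4 / R ^ 2) := by
  have hmeas := measurable_transportBound_empirical hm σ μ
  set ψ : (Fin m → ℝ) → ℝ → ℝ := fun z ξ => transportBound σ μ (empiricalMeasure z) ξ
  have hψ : ∀ z, Measurable (ψ z) := fun z => hmeas.comp measurable_prodMk_left
  have hw : Measurable fun ξ : ℝ => √(R ^ 2 + ξ ^ 2) := by fun_prop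
  have hw0 : ∀ ξ : ℝ, 0 < R ^ 2 + ξ ^ 2 := fun ξ => by positivity
  -- Cauchy–Schwarz against √(R²+ξ²) and its inverse, whose square has integral π/R.
  have hpt : ∀ z, (∫⁻ ξ, ENNReal.ofReal (ψ z ξ)) ^ 2 ≤ ENNReal.ofReal (Real.pi / R) *
      ∫⁻ ξ, ENNReal.ofReal (R ^ 2 + ξ ^ 2) * ENNReal.ofReal (ψ z ξ ^ 2) := by
    intro z
    have h := lintegral_mul_self_le volume (f := fun ξ : ℝ => ENNReal.ofReal (√(R ^ 2 + ξ ^ 2))⁻¹)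
      (g := fun ξ => ENNReal.ofReal (√(R ^ 2 + ξ ^ 2)) * ENNReal.ofReal (ψ z ξ))
      hw.inv.ennreal_ofReal.aemeasurable
      (hw.ennreal_ofReal.mul (hψ z).ennreal_ofReal).aemeasurable
    have e1 : ∀ ξ : ℝ, ENNReal.ofReal (√(R ^ 2 + ξ ^ 2))⁻¹ *
        (ENNReal.ofReal (√(R ^ 2 + ξ ^ 2)) * ENNReal.ofReal (ψ z ξ)) = ENNReal.ofReal (ψ z ξ) := by
      intro ξ
      rw [← mul_assoc, ← ENNReal.ofReal_mul (by positivity),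
        inv_mul_cancel₀ (Real.sqrt_pos.2 (hw0 ξ)).ne', ENNReal.ofReal_one, one_mul]
    have e2 : ∀ ξ : ℝ, ENNReal.ofReal (√(R ^ 2 + ξ ^ 2))⁻¹ ^ 2 =
        ENNReal.ofReal (R ^ 2 + ξ ^ 2)⁻¹ := by
      intro ξ
      rw [← ENNReal.ofReal_pow (by positivity), inv_pow, Real.sq_sqrt (hw0 ξ).le]
    simp_rw [e1, e2, lintegral_inv_sq_add_sq hR] at h
    refine h.trans (mul_le_mul_right (lintegral_mono fun ξ => ?_) _)
    rw [mul_pow, ← ENNReal.ofReal_pow (by positivity), Real.sq_sqrt (hw0 ξ).le]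
    gcongr
    rcases le_or_gt 0 (ψ z ξ) with h0 | h0
    · rw [ENNReal.ofReal_pow h0]
    · simp [ENNReal.ofReal_of_nonpos h0.le]
  have hjm : Measurable fun x : (Fin m → ℝ) × ℝ =>
      ENNReal.ofReal (R ^ 2 + x.2 ^ 2) * ENNReal.ofReal (ψ x.1 x.2 ^ 2) :=
    (by fun_prop : Measurable fun x : (Fin m → ℝ) × ℝ => ENNReal.ofReal (R ^ 2 + x.2 ^ 2)).mul
      (hmeas.pow_const 2).ennreal_ofReal
  calc _ ≤ ∫⁻ z : Fin m → ℝ, (ENNReal.ofReal (Real.pi / R) *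
        ∫⁻ ξ, ENNReal.ofReal (R ^ 2 + ξ ^ 2) * ENNReal.ofReal (ψ z ξ ^ 2))
        ∂(Measure.pi fun _ => μ) := lintegral_mono hpt
    _ = ENNReal.ofReal (Real.pi / R) * ∫⁻ ξ, ENNReal.ofReal (R ^ 2 + ξ ^ 2) *
          ∫⁻ z : Fin m → ℝ, ENNReal.ofReal (ψ z ξ ^ 2) ∂(Measure.pi fun _ => μ) := by
        rw [lintegral_const_mul _ hjm.lintegral_prod_right',
          lintegral_lintegral_swap hjm.aemeasurable]
        congr 1
        refine lintegral_congr fun ξ => ?_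
        have hξ : Measurable fun z => ENNReal.ofReal (ψ z ξ ^ 2) :=
          ((hmeas.comp measurable_prodMk_right).pow_const 2).ennreal_ofReal
        exact lintegral_const_mul (ENNReal.ofReal (R ^ 2 + ξ ^ 2)) hξ
    _ ≤ ENNReal.ofReal (Real.pi / R) * ∫⁻ ξ : ℝ, ENNReal.ofReal (4 * T ^ 4 * σ ^ 2) *
          ENNReal.ofReal (R ^ 2 + ξ ^ 2)⁻¹ := by
        refine mul_le_mul_right (lintegral_mono fun ξ => ?_) _
        refine (mul_le_mul_right (lintegral_transportBound_sq_le hm σ ξ) _).trans ?_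
        rw [← ENNReal.ofReal_mul (hw0 ξ).le, ← ENNReal.ofReal_mul (by positivity)]
        refine ENNReal.ofReal_le_ofReal ?_
        calc (R ^ 2 + ξ ^ 2) * (σ ^ 2 * min (cdf μ ξ) ((1 - cdf μ ξ) / m))
            ≤ (R ^ 2 + ξ ^ 2) * (σ ^ 2 * (4 * T ^ 4 / (R ^ 2 + ξ ^ 2) ^ 2)) := by
              gcongr
              exact min_cdf_le hT hR hm hRT hX ξ
          _ = _ := by
              have := (hw0 ξ).ne'
              field_simp
    _ = _ := by
        rw [lintegral_const_mul _ (by fun_prop), lintegral_inv_sq_add_sq hR,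
          ← ENNReal.ofReal_mul (by positivity), ← ENNReal.ofReal_mul (by positivity)]
        congr 1
        field_simp

end Transport

/-! ### Two-sided error and moment bounds. -/

section ErrorBound

variable {μ ν : Measure ℝ} [IsProbabilityMeasure μ] [IsProbabilityMeasure ν] {u u' : ℝ → ℝ}

/-- Lower bound for the objective under a change of distribution, through the monotone coupling. -/
lemma ofReal_oceObjective_sub_le (hu : IsUtility u u')
    (hμ : ∀ t, Integrable (fun x => u (-x - t)) μ) (hν : ∀ t, Integrable (fun x => u (-x - t)) ν)
    {t : ℝ} (hμ' : Integrable (fun x => u' (-x - t)) μ) (ht : ∫ x, u' (-x - t) ∂μ = 1) {σ : ℝ}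
    (hσ : 0 ≤ σ) (hσ' : ∫⁻ x, ENNReal.ofReal (u' (-x - t)) ^ 2 ∂μ ≤ ENNReal.ofReal (σ ^ 2))
    (s : ℝ) :
    ENNReal.ofReal (oceObjective u μ t - oceObjective u ν s) ≤
      ∫⁻ ξ, ENNReal.ofReal (transportBound σ μ ν ξ) := by
  set q : ℝ → ℝ := fun x => u' (-x - t) with hq
  have hqa : Antitone q := fun x y hxy => hu.deriv_mono (by linarith)
  refine le_trans ?_ (lintegral_quantile_sub_le (ν := ν) hσ hqa hσ')
  set L : Measure ℝ := volume.restrict (Set.Ioo 0 1)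
  have hpull : ∀ {ρ : Measure ℝ} [IsProbabilityMeasure ρ] {f : ℝ → ℝ}, Integrable f ρ →
      Integrable (fun p => f (quantile ρ p)) L ∧ ∫ p, f (quantile ρ p) ∂L = ∫ x, f x ∂ρ := by
    intro ρ _ f hf
    have hf' : Integrable f (L.map (quantile ρ)) := by rwa [map_quantile]
    refine ⟨hf'.comp_aemeasurable aemeasurable_quantile, ?_⟩
    rw [← integral_map aemeasurable_quantile hf'.aestronglyMeasurable, map_quantile]
  obtain ⟨i1, e1⟩ := hpull (hμ t)
  obtain ⟨i2, e2⟩ := hpull (hν s)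
  obtain ⟨i3, e3⟩ := hpull hμ'
  -- The added slope term has integral t - s because `u'` has mean 1 at t; it supplies exactly the
  -- shifts in the two objectives.
  set D : ℝ → ℝ := fun p => u (-quantile μ p - t) - u (-quantile ν p - s) +
    u' (-quantile μ p - t) * (t - s) with hD
  have iD : Integrable D L := (i1.sub i2).add (i3.mul_const _)
  have eD : ∫ p, D p ∂L = oceObjective u μ t - oceObjective u ν s := by
    have : ∫ p, D p ∂L = (∫ p, u (-quantile μ p - t) ∂L - ∫ p, u (-quantile ν p - s) ∂L) +
        (∫ p, u' (-quantile μ p - t) ∂L) * (t - s) := by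
      rw [← integral_sub i1 i2, ← integral_mul_const]
      exact integral_add (i1.sub i2) (i3.mul_const _)
    rw [this, e1, e2, e3, ht]
    unfold oceObjective
    ring
  rw [← eD]
  calc ENNReal.ofReal (∫ p, D p ∂L) ≤ ENNReal.ofReal (∫ p, max (D p) 0 ∂L) :=
        ENNReal.ofReal_le_ofReal (integral_mono iD iD.pos_part fun p => le_max_left _ _)
    _ = ∫⁻ p, ENNReal.ofReal (max (D p) 0) ∂L :=
        ofReal_integral_eq_lintegral_ofReal iD.pos_part
          (Eventually.of_forall fun p => le_max_right _ _)
    _ ≤ _ := by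
        refine lintegral_mono fun p => ?_
        have hq0 : 0 ≤ q (quantile μ p) := hu.deriv_nonneg _
        rw [← ENNReal.ofReal_mul hq0]
        have hDp : D p ≤ q (quantile μ p) * (quantile ν p - quantile μ p) := by
          have := hu.add_mul_sub_le (-quantile μ p - t) (-quantile ν p - s)
          simp only [hD, hq]
          linarith
        rcases le_or_gt 0 (D p) with h | h
        · rw [max_eq_left h]
          exact ENNReal.ofReal_le_ofReal hDp
        · rw [max_eq_right h.le]
          simp

lemma integral_le_sqrt_integral_sq {Ω : Type*} [MeasurableSpace Ω] {P : Measure Ω}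
    [IsProbabilityMeasure P] {f : Ω → ℝ} (hf : MemLp f 2 P) :
    ∫ ω, f ω ∂P ≤ √(∫ ω, f ω ^ 2 ∂P) := by
  refine Real.le_sqrt_of_sq_le ?_
  have h := variance_nonneg f P
  rw [variance_eq_sub hf] at h
  simp only [Pi.pow_apply] at h
  linarith

/-- Moment bounds from an upper estimate `A` and a second moment bound for the negative part. -/
lemma error_bounds_of_le {Ω : Type*} [MeasurableSpace Ω] {P : Measure Ω}
    [IsProbabilityMeasure P] {Δ A : Ω → ℝ} (hΔ : Measurable Δ) (hA : MemLp A 2 P)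
    (hle : ∀ ω, Δ ω ≤ A ω) {a b : ℝ} (ha : 0 ≤ a) (hb : 0 ≤ b) (hAa : ∫ ω, A ω ^ 2 ∂P ≤ a ^ 2)
    (hN : ∫⁻ ω, ENNReal.ofReal (-Δ ω) ^ 2 ∂P ≤ ENNReal.ofReal (b ^ 2)) :
    MemLp Δ 2 P ∧ ∫ ω, |Δ ω| ∂P ≤ b + a ∧ ∫ ω, |Δ ω| ^ 2 ∂P ≤ b ^ 2 + a ^ 2 := by
  set N : Ω → ℝ := fun ω => max (-Δ ω) 0 with hNdef
  have hN0 : ∀ ω, 0 ≤ N ω := fun ω => le_max_right _ _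
  have hNm : Measurable N := hΔ.neg.max measurable_const
  have hNsq : ∀ ω, ENNReal.ofReal (-Δ ω) ^ 2 = ENNReal.ofReal (N ω ^ 2) := fun ω => by
    rw [ENNReal.ofReal_pow (hN0 ω)]
    congr 1
    simp [hNdef]
  simp_rw [hNsq] at hN
  have hNint : Integrable (fun ω => N ω ^ 2) P := by
    refine ⟨(hNm.pow_const 2).aestronglyMeasurable, ?_⟩
    rw [hasFiniteIntegral_iff_ofReal (Eventually.of_forall fun ω => sq_nonneg _)]
    exact hN.trans_lt ENNReal.ofReal_lt_top
  have hNL : MemLp N 2 P := (memLp_two_iff_integrable_sq hNm.aestronglyMeasurable).2 hNint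
  have hNb : ∫ ω, N ω ^ 2 ∂P ≤ b ^ 2 := by
    rwa [← ofReal_integral_eq_lintegral_ofReal hNint (Eventually.of_forall fun ω => sq_nonneg _),
      ENNReal.ofReal_le_ofReal_iff (sq_nonneg b)] at hN
  have habs : ∀ ω, |Δ ω| ≤ N ω + |A ω| := fun ω => by
    refine abs_le'.2 ⟨?_, ?_⟩
    · linarith [hN0 ω, hle ω, le_abs_self (A ω)]
    · linarith [le_max_left (-Δ ω) 0, abs_nonneg (A ω)]
  have hsq : ∀ ω, |Δ ω| ^ 2 ≤ N ω ^ 2 + A ω ^ 2 := fun ω => by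
    rcases le_total 0 (Δ ω) with h | h
    · rw [abs_of_nonneg h]
      nlinarith [hle ω, sq_nonneg (N ω)]
    · have : N ω = |Δ ω| := by rw [abs_of_nonpos h]; exact max_eq_left (by linarith)
      rw [this]
      nlinarith [sq_nonneg (A ω)]
  have hΔL : MemLp Δ 2 P := (hNL.add hA.abs).mono hΔ.aestronglyMeasurable
    (Eventually.of_forall fun ω => (habs ω).trans (le_abs_self _))
  refine ⟨hΔL, ?_, ?_⟩
  · have h1 : ∫ ω, N ω ∂P ≤ b :=
      (integral_le_sqrt_integral_sq hNL).trans (Real.sqrt_le_iff.2 ⟨hb, hNb⟩)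
    have h2 : ∫ ω, |A ω| ∂P ≤ a := by
      refine (integral_le_sqrt_integral_sq hA.abs).trans (Real.sqrt_le_iff.2 ⟨ha, ?_⟩)
      simpa only [Pi.abs_apply, sq_abs] using hAa
    have iN := hNL.integrable one_le_two
    have iA := hA.abs.integrable one_le_two
    calc ∫ ω, |Δ ω| ∂P ≤ ∫ ω, (N ω + |A ω|) ∂P :=
          integral_mono (hΔL.integrable one_le_two).abs (iN.add iA) habs
      _ = ∫ ω, N ω ∂P + ∫ ω, |A ω| ∂P := integral_add iN iA
      _ ≤ _ := add_le_add h1 h2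
  · calc ∫ ω, |Δ ω| ^ 2 ∂P ≤ ∫ ω, (N ω ^ 2 + A ω ^ 2) ∂P :=
          integral_mono (by simpa only [sq_abs] using hΔL.integrable_sq)
            (hNint.add hA.integrable_sq) hsq
      _ = ∫ ω, N ω ^ 2 ∂P + ∫ ω, A ω ^ 2 ∂P := integral_add hNint hA.integrable_sq
      _ ≤ _ := add_le_add hNb hAa

lemma memLp_and_variance_le {Ω : Type*} [MeasurableSpace Ω] {P : Measure Ω}
    [IsProbabilityMeasure P] {f : Ω → ℝ} (hf : AEStronglyMeasurable f P) {c : ℝ} (hc : 0 ≤ c)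
    (h : evariance f P ≤ ENNReal.ofReal c) : MemLp f 2 P ∧ Var[f; P] ≤ c := by
  have hL : MemLp f 2 P := (evariance_lt_top_iff_memLp hf).1 (h.trans_lt ENNReal.ofReal_lt_top)
  rw [← ofReal_variance hL, ENNReal.ofReal_le_ofReal_iff hc] at h
  exact ⟨hL, h⟩

/-- Error bounds for the sample average approximation of the certainty equivalent, for an
independent sample realised on a product space. -/
theorem saaOce_error_bounds (hu : IsUtility u u')
    (h : ∀ t, Integrable (fun x => u (-x - t)) μ) (h' : ∀ t, Integrable (fun x => u' (-x - t)) μ)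
    (hAB : ContDiff ℝ 1 u ∨ Continuous (fun x : ℝ => cdf μ x)) {σ₂ σ₃ T : ℝ} (hσ₃ : 0 ≤ σ₃)
    (hvar₂ : evariance (fun x => u' (-x - shortfallRisk u' 1 id μ)) μ ≤ ENNReal.ofReal (σ₂ ^ 2))
    (hvar₃ : evariance (fun x => u (-x - shortfallRisk u' 1 id μ)) μ ≤ ENNReal.ofReal (σ₃ ^ 2))
    (hT : 0 < T) (hX : eLpNorm id 4 μ ≤ ENNReal.ofReal T) {m : ℕ} (hm : 1 ≤ m) :
    MemLp (fun z => saaOce u u' z - oceRisk u id μ) 2 (Measure.pi fun _ : Fin m => μ) ∧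
    ∫ z : Fin m → ℝ, |saaOce u u' z - oceRisk u id μ| ∂(Measure.pi fun _ => μ) ≤
      6 * √(3 * (σ₂ ^ 2 + 1)) * T / (m : ℝ) ^ (1 / 4 : ℝ) + σ₃ / √(m : ℝ) ∧
    ∫ z : Fin m → ℝ, |saaOce u u' z - oceRisk u id μ| ^ 2 ∂(Measure.pi fun _ => μ) ≤
      216 * (σ₂ ^ 2 + 1) * T ^ 2 / √(m : ℝ) + σ₃ ^ 2 / (m : ℝ) := by
  have hm0 : (0 : ℝ) < m := by positivity
  have hone := integral_deriv_shortfallRisk hu h' (ae_continuousAt_deriv hu hAB)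
  have hoce := oceRisk_id_eq hu h h'
  set t := shortfallRisk u' 1 id μ
  obtain ⟨hL2, hV2⟩ := memLp_and_variance_le (h' t).aestronglyMeasurable (sq_nonneg σ₂) hvar₂
  obtain ⟨hL3, hV3⟩ := memLp_and_variance_le (h t).aestronglyMeasurable (sq_nonneg σ₃) hvar₃
  -- The second moment of the weight is its variance plus the square of its mean, which is 1.
  set σ := √(σ₂ ^ 2 + 1)
  have hσ0 : 0 ≤ σ := Real.sqrt_nonneg _
  have hσsq : σ ^ 2 = σ₂ ^ 2 + 1 := Real.sq_sqrt (by positivity)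
  have hq2 : ∫⁻ x, ENNReal.ofReal (u' (-x - t)) ^ 2 ∂μ ≤ ENNReal.ofReal (σ ^ 2) := by
    simp_rw [← ENNReal.ofReal_pow (hu.deriv_nonneg _)]
    rw [← ofReal_integral_eq_lintegral_ofReal hL2.integrable_sq
      (Eventually.of_forall fun x => sq_nonneg _), hσsq]
    refine ENNReal.ofReal_le_ofReal ?_
    rw [variance_eq_sub hL2, hone] at hV2
    simp only [Pi.pow_apply] at hV2
    linarith
  set r : ℝ := (m : ℝ) ^ (1 / 4 : ℝ) with hr
  have hr0 : 0 < r := Real.rpow_pos_of_pos hm0 _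
  have hr4 : r ^ 4 = m := by
    rw [hr, ← Real.rpow_natCast, ← Real.rpow_mul hm0.le]
    norm_num
  have hr2 : √(m : ℝ) = r ^ 2 := by
    rw [← hr4, show r ^ 4 = (r ^ 2) ^ 2 by ring, Real.sqrt_sq (by positivity)]
  have hM := lintegral_sq_lintegral_transportBound_le (σ := σ) hT.le (mul_pos hT hr0) hm
    (by rw [mul_pow, hr4]; ring) hX
  have hb : (6 * √(3 * (σ₂ ^ 2 + 1)) * T / r) ^ 2 = 108 * ((σ₂ ^ 2 + 1) * T ^ 2 / r ^ 2) := by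
    rw [div_pow, mul_pow, mul_pow, Real.sq_sqrt (by positivity)]
    ring
  have hN : ∫⁻ z : Fin m → ℝ, ENNReal.ofReal (-(saaOce u u' z - oceRisk u id μ)) ^ 2
      ∂(Measure.pi fun _ => μ) ≤ ENNReal.ofReal ((6 * √(3 * (σ₂ ^ 2 + 1)) * T / r) ^ 2) := by
    refine (lintegral_mono fun z => ?_).trans (hM.trans (ENNReal.ofReal_le_ofReal ?_))
    · have := isProbabilityMeasure_empiricalMeasure hm z
      refine pow_le_pow_left₀ zero_le ?_ 2
      rw [neg_sub, hoce, saaOce_eq]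
      exact ofReal_oceObjective_sub_le hu h (fun t => integrable_empiricalMeasure hm z _) (h' t)
        hone hσ0 hq2 _
    · rw [hb, ← hσsq,
        show 4 * Real.pi ^ 2 * σ ^ 2 * T ^ 4 / (T * r) ^ 2 =
          4 * Real.pi ^ 2 * (σ ^ 2 * T ^ 2 / r ^ 2) by field_simp]
      refine mul_le_mul_of_nonneg_right ?_ (by positivity)
      -- The constant comparison is 4π² ≤ 108 = 6²·3.
      nlinarith [Real.pi_pos, Real.pi_lt_d2]
  have hA := integral_sampleMean_sub_sq hm hL3
  have hAa : ∫ z : Fin m → ℝ, ((1 / (m : ℝ)) * ∑ j, u (-z j - t) - ∫ x, u (-x - t) ∂μ) ^ 2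
      ∂(Measure.pi fun _ => μ) ≤ (σ₃ / √(m : ℝ)) ^ 2 := by
    rw [hA, div_pow, Real.sq_sqrt hm0.le]
    gcongr
  obtain ⟨c1, c2, c3⟩ := error_bounds_of_le (P := Measure.pi fun _ : Fin m => μ)
    (Δ := fun z => saaOce u u' z - oceRisk u id μ)
    ((measurable_saaOce hu hm).sub_const _) (memLp_sampleMean_sub hL3 (∫ x, u (-x - t) ∂μ))
    (fun z => by
      have := saaOce_le hu hm z t
      rw [hoce, oceObjective]
      linarith) (by positivity) (by positivity) hAa hN
  refine ⟨c1, c2, c3.trans ?_⟩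
  have hpos : 0 ≤ (σ₂ ^ 2 + 1) * T ^ 2 / r ^ 2 := by positivity
  rw [hb, div_pow, Real.sq_sqrt hm0.le, hr2,
    show 216 * (σ₂ ^ 2 + 1) * T ^ 2 / r ^ 2 = 216 * ((σ₂ ^ 2 + 1) * T ^ 2 / r ^ 2) by ring]
  linarith

end ErrorBound

/-! ### Transfer from random variables to their laws. -/

section Law

variable {Ω : Type*} [MeasurableSpace Ω] {P : Measure Ω} {X : Ω → ℝ}

lemma shortfallRisk_eq_map (hX : AEMeasurable X P) {l : ℝ → ℝ} (hl : Measurable l) (lam : ℝ) :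
    shortfallRisk l lam X P = shortfallRisk l lam id (P.map X) := by
  unfold shortfallRisk
  congr 1
  ext t
  rw [Set.mem_ofPred_eq, Set.mem_ofPred_eq, integral_map hX]
  · rfl
  · exact (by fun_prop : Measurable fun x : ℝ => l (-id x - t)).aestronglyMeasurable

lemma oceRisk_eq_map (hX : AEMeasurable X P) {u : ℝ → ℝ} (hu : Measurable u) :
    oceRisk u X P = oceRisk u id (P.map X) := by
  unfold oceRisk
  congr 1
  funext t
  rw [integral_map hX]
  · rfl
  · exact (by fun_prop : Measurable fun x : ℝ => u (-id x - t)).aestronglyMeasurable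

lemma evariance_comp_eq_map (hX : AEMeasurable X P) {f : ℝ → ℝ} (hf : Measurable f) :
    evariance (fun ω => f (X ω)) P = evariance f (P.map X) := by
  have hm : Measurable fun x => ‖f x - (P.map X)[f]‖ₑ ^ 2 :=
    (hf.sub_const _).enorm.pow_const 2
  rw [evariance, evariance, lintegral_map' hm.aemeasurable hX,
    integral_map hX hf.aestronglyMeasurable]

end Law

end
theorem mainTheorem8
    {Ω Ω' : Type*} [MeasurableSpace Ω] [MeasurableSpace Ω']
    (P : Measure Ω) [IsProbabilityMeasure P] (P' : Measure Ω') [IsProbabilityMeasure P']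
    -- the utility function and its derivative
    (u u' : ℝ → ℝ) (hu : IsUtility u u')
    -- the random variable
    (X : Ω → ℝ) (hXu : MemRiskSpace u X P) (hXu' : MemRiskSpace u' X P)
    -- either `u` is continuously differentiable, or the CDF of `X` is continuous
    (hAB : ContDiff ℝ 1 u ∨ Continuous (fun x : ℝ => cdf (P.map X) x))
    -- variance bounds (extended variances: the variances are finite and bounded)
    (σ₂ σ₃ : ℝ) (hσ₂ : 0 < σ₂) (hσ₃ : 0 < σ₃)
    (hvar₂ : evariance (fun ω => u' (-X ω - shortfallRisk u' 1 X P)) P ≤ ENNReal.ofReal (σ₂ ^ 2))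
    (hvar₃ : evariance (fun ω => u (-X ω - shortfallRisk u' 1 X P)) P ≤ ENNReal.ofReal (σ₃ ^ 2))
    -- moment bound
    (q : ENNReal) (hq : 4 < q) (T : ℝ) (hT : 0 < T) (hX : eLpNorm X q P ≤ ENNReal.ofReal T)
    -- `m` independent samples from the distribution of `X`
    (m : ℕ) (hm : 1 ≤ m) (Z : Fin m → Ω' → ℝ)
    (hZ_indep : iIndepFun Z P') (hZ_law : ∀ i, IdentDistrib (Z i) X P' P) :
    MemLp (fun ω => saaOce u u' (fun i => Z i ω) - oceRisk u X P) 2 P' ∧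
    ∫ ω, |saaOce u u' (fun i => Z i ω) - oceRisk u X P| ∂P' ≤
      6 * √(3 * (σ₂ ^ 2 + 1)) * T / (m : ℝ) ^ (1 / 4 : ℝ) + σ₃ / √(m : ℝ) ∧
    ∫ ω, |saaOce u u' (fun i => Z i ω) - oceRisk u X P| ^ 2 ∂P' ≤
      216 * (σ₂ ^ 2 + 1) * T ^ 2 / √(m : ℝ) + σ₃ ^ 2 / (m : ℝ) := by
  have hXm := hXu.measurable.aemeasurable (μ := P)
  have hum := hu.continuous.measurable
  have hum' := hu.measurable_deriv
  have hprob : IsProbabilityMeasure (P.map X) := Measure.isProbabilityMeasure_map hXm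
  have htrans : ∀ {f : ℝ → ℝ}, Measurable f → ∀ t : ℝ, Measurable fun x : ℝ => f (-x - t) :=
    fun hf t => hf.comp (measurable_neg.sub_const t)
  have hint : ∀ t, Integrable (fun x => u (-x - t)) (P.map X) := fun t =>
    (integrable_map_measure (htrans hum t).aestronglyMeasurable hXm).2 (hXu.integrable t)
  have hint' : ∀ t, Integrable (fun x => u' (-x - t)) (P.map X) := fun t =>
    (integrable_map_measure (htrans hum' t).aestronglyMeasurable hXm).2 (hXu'.integrable t)
  have hX4 : eLpNorm id 4 (P.map X) ≤ ENNReal.ofReal T := by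
    rw [eLpNorm_map_measure aestronglyMeasurable_id hXm]
    exact (eLpNorm_le_eLpNorm_of_exponent_le hq.le hXm.aestronglyMeasurable).trans hX
  rw [shortfallRisk_eq_map hXm hum'] at hvar₂ hvar₃
  have hvar₂' := (evariance_comp_eq_map hXm (htrans hum' _)).symm.trans_le hvar₂
  have hvar₃' := (evariance_comp_eq_map hXm (htrans hum _)).symm.trans_le hvar₃
  have hZm : AEMeasurable (fun ω i => Z i ω) P' :=
    aemeasurable_pi_lambda _ fun i => (hZ_law i).aemeasurable_fst
  have hZ : P'.map (fun ω i => Z i ω) = Measure.pi fun _ => P.map X := by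
    rw [(iIndepFun_iff_map_fun_eq_pi_map fun i => (hZ_law i).aemeasurable_fst).1 hZ_indep]
    simp_rw [(hZ_law _).map_eq]
  obtain ⟨c1, c2, c3⟩ :=
    saaOce_error_bounds hu hint hint' hAB hσ₃.le hvar₂' hvar₃' hT hX4 hm
  rw [oceRisk_eq_map hXm hum]
  have hΔ : Measurable fun z : Fin m → ℝ => saaOce u u' z - oceRisk u id (P.map X) :=
    (measurable_saaOce hu hm).sub_const _
  rw [← hZ] at c1 c2 c3
  rw [integral_map hZm hΔ.abs.aestronglyMeasurable] at c2
  rw [integral_map hZm (hΔ.abs.pow_const 2).aestronglyMeasurable] at c3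
  exact ⟨c1.comp_of_map hZm, c2, c3⟩
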